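/- **Lower bound for the quantum linear system problem (QLS) in condition number and target error.** *Problem.* Let $A\in\mathbb{C}^{N\times N}$ be invertible with condition number $\|A\|\,\|A^{-1}\|=\kappa$ (spectral norm) and at most $s$ non-zero entries in each row and column, and let $|b\rangle$ be a known quantum state. With target error $\epsilon$, QLS asks to prepare a state $|\tilde x\rangle$ with $\||\tilde x\rangle-|x\rangle\|\le\epsilon$, where $|x\rangle=A^{-1}|b\rangle/\|A^{-1}|b\rangle\|$. Auxiliary registers may be used: it suffices that the final state is within $\epsilon$ of $|x\rangle\otimes|g\rangle$ for some state $|g\rangle$ of the auxiliary registers. *Access.* The matrix $A$ is accessible only through the oracles $|i,\nu\rangle\mapsto|i,j(i,\nu)\rangle$ and $|i,j,z\rangle\mapsto|i,j,A_{i,j}\oplus z\rangle$. For $\nu\le s$, $j(i,\nu)$ is the column of the $\nu$-th non-zero entry of row $i$, or the column of any zero entry of row $i$ if the row has fewer than $\nu$ non-zero entries; each $j(i,\cdot)$ is a bijection of $\{1,\dots,N\}$. Entries are encoded by bit strings of some fixed length $m$, distinct representable numbers having distinct codes. An algorithm alternates oracle calls (controlled, inverses allowed) with arbitrary unitaries independent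 of $A$; it has to succeed for every such $A$ with representable entries and for every admissible $j$. The query complexity is the least number of oracle calls that suffices, for the worst $|b\rangle$. *Theorem.* The query complexity of QLS is $\Omega(\kappa\log(1/\epsilon))$ for every fixed sparsity $s\ge2$ and target error $0<\epsilon<1/6$. Precisely, there are constants $c,C>0$ and $\kappa_0$ such that for every $\kappa\ge\kappa_0$ there is a finite set $V\subset\mathbb{C}$ such that for all $s\ge2$, all $0<\epsilon<1/6$, all dimensions $N\ge C\,\kappa\log(1/\epsilon)$, and all fixed-length encodings in which the numbers in $V$ are representable, the query complexity of QLS is at least $c\,\kappa\log(1/\epsilon)$. -/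

import Mathlib

open scoped ENNReal

noncomputable section

namespace QLS

/-! ### The linear system problem -/

/-- The condition number `‖A‖ ‖A⁻¹‖` in the spectral norm (the operator norm for `ℓ²`). -/
def condNumber {N : ℕ} (A : Matrix (Fin N) (Fin N) ℂ) : ℝ :=
  ‖Matrix.toEuclideanCLM (n := Fin N) (𝕜 := ℂ) A‖ *
    ‖Matrix.toEuclideanCLM (n := Fin N) (𝕜 := ℂ) A⁻¹‖

/-- The columns of the nonzero entries of row `i`. -/
def rowSupport {N : ℕ} (A : Matrix (Fin N) (Fin N) ℂ) (i : Fin N) : Finset (Fin N) :=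
  Finset.univ.filter fun j => A i j ≠ 0

/-- The rows of the nonzero entries of column `j`. -/
def colSupport {N : ℕ} (A : Matrix (Fin N) (Fin N) ℂ) (j : Fin N) : Finset (Fin N) :=
  Finset.univ.filter fun i => A i j ≠ 0

/-- At most `s` nonzero entries in each row and in each column. -/
def IsSparse {N : ℕ} (s : ℕ) (A : Matrix (Fin N) (Fin N) ℂ) : Prop :=
  (∀ i, (rowSupport A i).card ≤ s) ∧ ∀ j, (colSupport A j).card ≤ s

/-- The unnormalized solution `A⁻¹ b`. -/
def solutionVec {N : ℕ} (A : Matrix (Fin N) (Fin N) ℂ) (b : EuclideanSpace ℂ (Fin N)) :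
    EuclideanSpace ℂ (Fin N) :=
  Matrix.toEuclideanCLM (n := Fin N) (𝕜 := ℂ) A⁻¹ b

/-- The solution state `|x⟩ = A⁻¹|b⟩ / ‖A⁻¹|b⟩‖`. -/
def solutionState {N : ℕ} (A : Matrix (Fin N) (Fin N) ℂ) (b : EuclideanSpace ℂ (Fin N)) :
    EuclideanSpace ℂ (Fin N) :=
  ((‖solutionVec A b‖⁻¹ : ℝ) : ℂ) • solutionVec A b

/-! ### The sparse-matrix oracles -/

/-- A fixed-length binary number format: a finite set of representable complex numbers, each
with its own bit string of length `m`. -/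
structure NumberFormat (m : ℕ) where
  values : Finset ℂ
  code : ℂ → Fin m → Bool
  code_injOn : Set.InjOn code values

/-- `π` is a position function for the `s`-sparse matrix `A`: for `ν < s` (counting from zero),
`π i ν` is the column of the `ν`-th nonzero entry of row `i`, and the column of some zero entry
of row `i` if that row does not have so many nonzero entries. As `|i, ν⟩ ↦ |i, π i ν⟩` is
unitary, `π i` is a bijection; its values at labels `ν ≥ s` are not constrained. -/
def IsPositionFunction {N : ℕ} (s : ℕ) (A : Matrix (Fin N) (Fin N) ℂ)
    (π : Fin N → Equiv.Perm (Fin N)) : Prop :=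
  ∀ i ν : Fin N, (ν : ℕ) < s →
    (∀ h : (ν : ℕ) < (rowSupport A i).card,
      π i ν = (rowSupport A i).orderEmbOfFin rfl ⟨ν, h⟩) ∧
    ((rowSupport A i).card ≤ (ν : ℕ) → A i (π i ν) = 0)

/-- All registers but the output register: a control bit, the second index register, the value
register of `m` bits, and a workspace of dimension `d`. -/
abbrev Rest (N m d : ℕ) : Type := Bool × Fin N × (Fin m → Bool) × Fin d

/-- Labels of the computational basis. The first register is the first index register of the
oracles; at the end of the computation it is the output register. -/
abbrev Reg (N m d : ℕ) : Type := Fin N × Rest N m d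

/-- The state space of the computation. -/
abbrev StateSpace (N m d : ℕ) : Type := EuclideanSpace ℂ (Reg N m d)

/-- The controlled position oracle on basis labels: `|i, ν⟩ ↦ |i, π i ν⟩` if the control bit
is set. -/
def posPerm {N : ℕ} (m d : ℕ) (π : Fin N → Equiv.Perm (Fin N)) : Equiv.Perm (Reg N m d) where
  toFun r := (r.1, r.2.1, if r.2.1 then π r.1 r.2.2.1 else r.2.2.1, r.2.2.2)
  invFun r := (r.1, r.2.1, if r.2.1 then (π r.1).symm r.2.2.1 else r.2.2.1, r.2.2.2)
  left_inv := by
    rintro ⟨i, c, j, z, w⟩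
    cases c <;> simp
  right_inv := by
    rintro ⟨i, c, j, z, w⟩
    cases c <;> simp

/-- The controlled value oracle on basis labels: `|i, j, z⟩ ↦ |i, j, z ⊕ e i j⟩` if the control
bit is set. -/
def valPerm {N m : ℕ} (d : ℕ) (e : Fin N → Fin N → Fin m → Bool) :
    Equiv.Perm (Reg N m d) where
  toFun r := (r.1, r.2.1, r.2.2.1,
    if r.2.1 then (fun k => xor (e r.1 r.2.2.1 k) (r.2.2.2.1 k)) else r.2.2.2.1, r.2.2.2.2)
  invFun r := (r.1, r.2.1, r.2.2.1,
    if r.2.1 then (fun k => xor (e r.1 r.2.2.1 k) (r.2.2.2.1 k)) else r.2.2.2.1, r.2.2.2.2)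
  left_inv := by
    rintro ⟨i, c, j, z, w⟩
    cases c <;> simp
  right_inv := by
    rintro ⟨i, c, j, z, w⟩
    cases c <;> simp

/-- The oracle calls: the position oracle, its inverse, and the value oracle (which is its own
inverse). All of them are controlled. -/
inductive OracleCall where
  | pos : OracleCall
  | posInv : OracleCall
  | val : OracleCall

/-- The permutation of the basis labels that an oracle call performs. -/
def OracleCall.perm {N m : ℕ} (d : ℕ) (π : Fin N → Equiv.Perm (Fin N))
    (e : Fin N → Fin N → Fin m → Bool) : OracleCall → Equiv.Perm (Reg N m d)
  | .pos => posPerm m d π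
  | .posInv => (posPerm m d π).symm
  | .val => valPerm d e

/-- The unitary operator `|r⟩ ↦ |perm r⟩` of an oracle call. -/
def OracleCall.unitary {N m : ℕ} (d : ℕ) (π : Fin N → Equiv.Perm (Fin N))
    (e : Fin N → Fin N → Fin m → Bool) (o : OracleCall) :
    StateSpace N m d ≃ₗᵢ[ℂ] StateSpace N m d :=
  LinearIsometryEquiv.piLpCongrLeft 2 ℂ ℂ (o.perm d π e)

/-! ### Quantum query algorithms -/

/-- A quantum query algorithm: a workspace dimension, an initial state, and a list of steps,
each of which is one oracle call followed by an arbitrary unitary that does not depend on the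
oracle. -/
structure QueryAlgorithm (N m : ℕ) where
  workDim : ℕ
  init : StateSpace N m workDim
  norm_init : ‖init‖ = 1
  steps : List (OracleCall × (StateSpace N m workDim ≃ₗᵢ[ℂ] StateSpace N m workDim))

/-- The number of oracle calls. -/
def QueryAlgorithm.queryCount {N m : ℕ} (alg : QueryAlgorithm N m) : ℕ := alg.steps.length

/-- The final state of the algorithm on the oracles given by `π` and `e`. -/
def QueryAlgorithm.finalState {N m : ℕ} (alg : QueryAlgorithm N m)
    (π : Fin N → Equiv.Perm (Fin N)) (e : Fin N → Fin N → Fin m → Bool) :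
    StateSpace N m alg.workDim :=
  alg.steps.foldl (fun ψ st => st.2 (st.1.unitary alg.workDim π e ψ)) alg.init

/-- The product state `|x⟩ ⊗ |g⟩` of the output register and the remaining registers. -/
def tensorState {N m d : ℕ} (x : EuclideanSpace ℂ (Fin N)) (g : EuclideanSpace ℂ (Rest N m d)) :
    StateSpace N m d :=
  WithLp.toLp 2 fun r => x r.1 * g r.2

/-- The final state `Φ` holds `|x⟩` in the output register up to error `ε`: it is within `ε` of
`|x⟩ ⊗ |g⟩` for some state `|g⟩` of the other registers. In particular this is so for
`Φ = |x'⟩ ⊗ |g⟩` with `‖|x'⟩ - |x⟩‖ ≤ ε`. -/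
def Prepares {N m d : ℕ} (ε : ℝ) (Φ : StateSpace N m d) (x : EuclideanSpace ℂ (Fin N)) : Prop :=
  ∃ g : EuclideanSpace ℂ (Rest N m d), ‖g‖ = 1 ∧ ‖Φ - tensorState x g‖ ≤ ε

/-- The algorithm solves the quantum linear system problem with right-hand side `b` and target
error `ε` for every invertible `s`-sparse `N × N` matrix of condition number `κ` with
representable entries, whichever position function its oracle uses. -/
def Solves {N m : ℕ} (s : ℕ) (κ ε : ℝ) (F : NumberFormat m) (b : EuclideanSpace ℂ (Fin N))
    (alg : QueryAlgorithm N m) : Prop :=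
  ∀ A : Matrix (Fin N) (Fin N) ℂ, IsUnit A → IsSparse s A → condNumber A = κ →
    (∀ i j, A i j ∈ F.values) →
    ∀ π : Fin N → Equiv.Perm (Fin N), IsPositionFunction s A π →
      Prepares ε (alg.finalState π fun i j => F.code (A i j)) (solutionState A b)

/-- The query complexity of the quantum linear system problem: the number of oracle calls that
suffice for the worst right-hand side. The algorithm may be tailored to all the parameters and
to the (known) state `b`. -/
def queryComplexity (N s : ℕ) (κ ε : ℝ) {m : ℕ} (F : NumberFormat m) : ℕ∞ :=
  ⨆ b : {b : EuclideanSpace ℂ (Fin N) // ‖b‖ = 1},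
    ⨅ alg : {alg : QueryAlgorithm N m // Solves s κ ε F b.1 alg}, (alg.1.queryCount : ℕ∞)

end QLS

end

/-!
The lower bound comes from computing the parity of `n ≈ κ log (1 / ε) / 4` bits.

For a permutation matrix `P` and `r = (κ - 1) / (κ + 1)` the matrix `A = 1 - r P` has at most two
nonzero entries in each row and column. As `P` is unitary, `‖A‖ ≤ 1 + r` and
`‖A⁻¹‖ ≤ 1 / (1 - r)`, with equality as soon as `P` has the eigenvalues `1` and `-1`, which a
2-cycle ensures; so the condition number is exactly `κ` (`condNumber_oneSubPerm`).

The permutation is a walk `walkPerm` on pairs of a time `k` (modulo `2 n + M`) and a parity bit.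
During the first `n` steps the walk adds the input bits `x₀, x₁, …` to the parity bit, during `M`
steps it leaves that bit alone, and during the last `n` steps it removes the input bits again, so
that it returns to its starting point. A step of the walk, hence a row of `A`, hence an oracle
answer, depends on at most one input bit. With the starting point as right-hand side, the solution
`A⁻¹ b ∝ ∑ rᵏ Pᵏ b` decays geometrically along the walk, and at the times `n ≤ k < n + M` its
parity bit is the parity of the input. These times carry the fraction
`r ^ (2 n) (1 - r ^ (2 M))`, at least, of the squared norm, which exceeds `(2 ε) ^ 2` for
`n ≤ (κ - 1) log (1 / ε) / 4` and `M ≥ κ + 1` (`weight_bound`). So any state within `ε` of the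
solution is more likely to be found at these times with the correct parity bit than with the wrong
one (`Prepares.blockProb_lt`).

By the polynomial method the amplitudes after `T` calls have degree at most `T` in the input bits,
and the difference of the two probabilities has degree at most `2 T`. As its sign is always that of
the parity, it is correlated with the parity, which is orthogonal to all functions of degree less
than `n`. Hence `2 T ≥ n` (`QueryAlgorithm.card_le_two_mul_queryCount`).
-/

namespace QLS

/-! ### Functions of low degree on the Boolean cube -/

/-- The functions on `ι → ZMod 2` of degree at most `t`: the linear combinations of functions
that depend on at most `t` coordinates. -/
def lowDegree (ι : Type*) (t : ℕ) : Submodule ℂ ((ι → ZMod 2) → ℂ) :=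
  Submodule.span ℂ {g | ∃ S : Finset ι, S.card ≤ t ∧ DependsOn g (S : Set ι)}

section LowDegree

variable {ι : Type*}

lemma mem_lowDegree_of_dependsOn {t : ℕ} {g : (ι → ZMod 2) → ℂ} {S : Finset ι}
    (hS : S.card ≤ t) (hg : DependsOn g (S : Set ι)) : g ∈ lowDegree ι t :=
  Submodule.subset_span ⟨S, hS, hg⟩

lemma const_mem_lowDegree (t : ℕ) (a : ℂ) : (fun _ => a) ∈ lowDegree ι t :=
  mem_lowDegree_of_dependsOn (S := ∅) (by simp) fun _ _ _ => rfl

lemma mul_mem_lowDegree {s t : ℕ} {f g : (ι → ZMod 2) → ℂ} (hf : f ∈ lowDegree ι s)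
    (hg : g ∈ lowDegree ι t) : f * g ∈ lowDegree ι (s + t) := by
  classical
  have h : f * g ∈ lowDegree ι s * lowDegree ι t := Submodule.mul_mem_mul hf hg
  unfold lowDegree at h ⊢
  rw [Submodule.span_mul_span] at h
  refine Submodule.span_mono ?_ h
  rintro _ ⟨f, ⟨S, hS, hf⟩, g, ⟨T, hT, hg⟩, rfl⟩
  refine ⟨S ∪ T, (Finset.card_union_le _ _).trans (by omega), fun x y hxy => ?_⟩
  have h1 : f x = f y := hf fun i hi => hxy i (by simp_all)
  have h2 : g x = g y := hg fun i hi => hxy i (by simp_all)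
  simp [h1, h2]

lemma conj_mem_lowDegree {t : ℕ} {f : (ι → ZMod 2) → ℂ} (hf : f ∈ lowDegree ι t) :
    (fun x => (starRingEnd ℂ) (f x)) ∈ lowDegree ι t := by
  induction hf using Submodule.span_induction with
  | mem g hg =>
    obtain ⟨S, hS, hg⟩ := hg
    refine mem_lowDegree_of_dependsOn hS fun x y hxy => ?_
    simp only [hg hxy]
  | zero => simpa using const_mem_lowDegree t (0 : ℂ)
  | add f g _ _ hf hg =>
    convert (lowDegree ι t).add_mem hf hg using 1
    ext x
    simp
  | smul a f _ hf =>
    convert (lowDegree ι t).smul_mem ((starRingEnd ℂ) a) hf using 1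
    ext x
    simp

/-- The parity character `x ↦ (-1) ^ ∑ xᵢ`. -/
noncomputable def parityChar [Fintype ι] (x : ι → ZMod 2) : ℂ := if ∑ i, x i = 0 then 1 else -1

lemma parityChar_add_single [Fintype ι] [DecidableEq ι] (x : ι → ZMod 2) (i : ι) :
    parityChar (x + Pi.single i 1) = -parityChar x := by
  have h : ∀ a : ZMod 2, (if a + 1 = 0 then (1 : ℂ) else -1) = -(if a = 0 then 1 else -1) := by
    intro a
    have h2 : a = 0 ∨ a = 1 := by decide +revert
    rcases h2 with rfl | rfl
    · simp
    · rw [show (1 : ZMod 2) + 1 = 0 from rfl]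
      simp
  simpa [parityChar, Finset.sum_add_distrib] using h (∑ i, x i)

/-- The parity is orthogonal to all functions of degree less than the number of variables:
flipping a variable on which a function does not depend changes the sign of the correlation. -/
lemma sum_parityChar_mul_eq_zero [Fintype ι] [DecidableEq ι] {t : ℕ} (ht : t < Fintype.card ι)
    {f : (ι → ZMod 2) → ℂ} (hf : f ∈ lowDegree ι t) : ∑ x, parityChar x * f x = 0 := by
  induction hf using Submodule.span_induction with
  | mem g hg =>
    obtain ⟨S, hS, hg⟩ := hg
    obtain ⟨i, hi⟩ : ∃ i, i ∉ S := by
      by_contra! h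
      have : S = Finset.univ := Finset.eq_univ_iff_forall.2 h
      rw [this, Finset.card_univ] at hS
      omega
    have key : ∑ x, parityChar x * g x = -∑ x, parityChar x * g x := by
      conv_lhs => rw [← Equiv.sum_comp (Equiv.addRight (Pi.single i (1 : ZMod 2)))]
      rw [← Finset.sum_neg_distrib]
      refine Finset.sum_congr rfl fun x _ => ?_
      have hgx : g (x + Pi.single i 1) = g x := hg fun j hj => by
        have hne : j ≠ i := fun h => hi (h ▸ hj)
        simp [hne]
      rw [Equiv.coe_addRight, parityChar_add_single, hgx, neg_mul]
    exact self_eq_neg.1 key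
  | zero => simp
  | add f g _ _ hf hg => simp [mul_add, Finset.sum_add_distrib, hf, hg]
  | smul a f _ hf =>
    simp only [Pi.smul_apply, smul_eq_mul, mul_left_comm _ a]
    rw [← Finset.mul_sum, hf, mul_zero]

end LowDegree

/-! ### The polynomial method -/

section PolynomialMethod

variable {N m d : ℕ} {ι : Type*} {π : (ι → ZMod 2) → Fin N → Equiv.Perm (Fin N)}
  {e : (ι → ZMod 2) → Fin N → Fin N → Fin m → Bool}

/-- Each row of the matrix that the oracles describe depends on at most one input bit. -/
def RowsDependOnOneBit (π : (ι → ZMod 2) → Fin N → Equiv.Perm (Fin N))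
    (e : (ι → ZMod 2) → Fin N → Fin N → Fin m → Bool) : Prop :=
  ∀ i, ∃ S : Finset ι, S.card ≤ 1 ∧ DependsOn (fun x => (π x i, e x i)) (S : Set ι)

lemma OracleCall.perm_symm_apply_congr {π π' : Fin N → Equiv.Perm (Fin N)}
    {e e' : Fin N → Fin N → Fin m → Bool} (o : OracleCall) (r : Reg N m d)
    (hπ : π r.1 = π' r.1) (he : e r.1 = e' r.1) :
    (o.perm d π e).symm r = (o.perm d π' e').symm r := by
  cases o <;> simp [OracleCall.perm, posPerm, valPerm, hπ, he]

/-- An oracle call raises the degree of the amplitudes by at most one: the basis state that is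
sent to a given one is determined by one row, hence by one bit. -/
lemma unitary_apply_mem_lowDegree (h : RowsDependOnOneBit π e) (o : OracleCall) {t : ℕ}
    {ψ : (ι → ZMod 2) → StateSpace N m d} (hψ : ∀ r, (fun x => ψ x r) ∈ lowDegree ι t)
    (r : Reg N m d) :
    (fun x => o.unitary d (π x) (e x) (ψ x) r) ∈ lowDegree ι (t + 1) := by
  classical
  obtain ⟨S, hS, hdep⟩ := h r.1
  have hsum : (fun x => o.unitary d (π x) (e x) (ψ x) r) = ∑ r' : Reg N m d,
      (fun x => ψ x r') * fun x => if (o.perm d (π x) (e x)).symm r = r' then (1 : ℂ) else 0 := by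
    ext x
    simp [OracleCall.unitary, LinearIsometryEquiv.piLpCongrLeft_apply, Finset.sum_apply]
  rw [hsum]
  refine Submodule.sum_mem _ fun r' _ => mul_mem_lowDegree (hψ r') ?_
  refine mem_lowDegree_of_dependsOn hS fun x y hxy => ?_
  have h2 := Prod.ext_iff.1 (hdep hxy)
  simp only [o.perm_symm_apply_congr r h2.1 h2.2]

lemma linearMap_apply_mem_lowDegree (U : StateSpace N m d →ₗ[ℂ] StateSpace N m d) {t : ℕ}
    {ψ : (ι → ZMod 2) → StateSpace N m d} (hψ : ∀ r, (fun x => ψ x r) ∈ lowDegree ι t)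
    (r : Reg N m d) : (fun x => U (ψ x) r) ∈ lowDegree ι t := by
  classical
  have hsum : (fun x => U (ψ x) r) = ∑ r' : Reg N m d,
      U (EuclideanSpace.single r' 1) r • fun x => ψ x r' := by
    ext x
    have hx : ψ x = ∑ r', ψ x r' • EuclideanSpace.single r' (1 : ℂ) := by
      ext q
      simp [Pi.single_apply]
    conv_lhs => rw [hx]
    simp [mul_comm]
  rw [hsum]
  exact Submodule.sum_mem _ fun r' _ => Submodule.smul_mem _ _ (hψ r')

/-- After `T` oracle calls the amplitudes have degree at most `T` in the input bits. -/
lemma QueryAlgorithm.finalState_mem_lowDegree (h : RowsDependOnOneBit π e)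
    (alg : QueryAlgorithm N m) (r : Reg N m alg.workDim) :
    (fun x => alg.finalState (π x) (e x) r) ∈ lowDegree ι alg.queryCount := by
  suffices H : ∀ (l : List (OracleCall ×
      (StateSpace N m alg.workDim ≃ₗᵢ[ℂ] StateSpace N m alg.workDim))) (t : ℕ)
      (ψ : (ι → ZMod 2) → StateSpace N m alg.workDim),
      (∀ r, (fun x => ψ x r) ∈ lowDegree ι t) → ∀ r,
      (fun x => l.foldl (fun ψ st => st.2 (st.1.unitary alg.workDim (π x) (e x) ψ)) (ψ x) r) ∈
        lowDegree ι (t + l.length) by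
    have := H alg.steps 0 (fun _ => alg.init) (fun r => const_mem_lowDegree 0 _) r
    rwa [zero_add] at this
  intro l
  induction l with
  | nil => exact fun t ψ hψ r => hψ r
  | cons st l ih =>
    intro t ψ hψ r
    have := ih (t + 1) (fun x => st.2 (st.1.unitary alg.workDim (π x) (e x) (ψ x)))
      (linearMap_apply_mem_lowDegree st.2.toLinearEquiv.toLinearMap
        (unitary_apply_mem_lowDegree h st.1 hψ)) r
    rw [List.length_cons, add_comm l.length, ← add_assoc]
    exact this

/-- The probability of finding the output register in `B`. -/
noncomputable def blockProb (B : Finset (Fin N)) (Φ : StateSpace N m d) : ℝ :=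
  ∑ r : Reg N m d, if r.1 ∈ B then ‖Φ r‖ ^ 2 else 0

lemma QueryAlgorithm.blockProb_mem_lowDegree (h : RowsDependOnOneBit π e)
    (alg : QueryAlgorithm N m) (B : Finset (Fin N)) :
    (fun x => (blockProb B (alg.finalState (π x) (e x)) : ℂ)) ∈
      lowDegree ι (alg.queryCount + alg.queryCount) := by
  have hsum : (fun x => (blockProb B (alg.finalState (π x) (e x)) : ℂ)) =
      ∑ r : Reg N m alg.workDim, if r.1 ∈ B then (fun x => alg.finalState (π x) (e x) r) *
        (fun x => (starRingEnd ℂ) (alg.finalState (π x) (e x) r)) else 0 := by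
    ext x
    simp only [blockProb, Complex.ofReal_sum, Finset.sum_apply]
    refine Finset.sum_congr rfl fun r _ => ?_
    split_ifs
    · simp [Complex.mul_conj, Complex.normSq_eq_norm_sq]
    · simp
  rw [hsum]
  refine Submodule.sum_mem _ fun r _ => ?_
  split_ifs
  · exact mul_mem_lowDegree (alg.finalState_mem_lowDegree h r)
      (conj_mem_lowDegree (alg.finalState_mem_lowDegree h r))
  · exact Submodule.zero_mem _

/-- An algorithm that favours the block of the correct parity, by however small a margin, makes
at least half as many calls as there are input bits. -/
theorem QueryAlgorithm.card_le_two_mul_queryCount [Fintype ι] [DecidableEq ι]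
    (h : RowsDependOnOneBit π e)
    (alg : QueryAlgorithm N m) (B : ZMod 2 → Finset (Fin N))
    (hB : ∀ x, blockProb (B (∑ i, x i + 1)) (alg.finalState (π x) (e x)) <
      blockProb (B (∑ i, x i)) (alg.finalState (π x) (e x))) :
    Fintype.card ι ≤ 2 * alg.queryCount := by
  by_contra! hlt
  have h0 := sum_parityChar_mul_eq_zero (by omega : alg.queryCount + alg.queryCount < _)
    (Submodule.sub_mem _ (alg.blockProb_mem_lowDegree h (B 0))
      (alg.blockProb_mem_lowDegree h (B 1)))
  have hcast : ∑ x, parityChar x * ((fun x => (blockProb (B 0) (alg.finalState (π x) (e x)) : ℂ)) -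
      fun x => (blockProb (B 1) (alg.finalState (π x) (e x)) : ℂ)) x =
      ((∑ x : ι → ZMod 2, (blockProb (B (∑ i, x i)) (alg.finalState (π x) (e x)) -
        blockProb (B (∑ i, x i + 1)) (alg.finalState (π x) (e x))) : ℝ) : ℂ) := by
    rw [Complex.ofReal_sum]
    refine Finset.sum_congr rfl fun x _ => ?_
    have h2 : ∀ a : ZMod 2, a = 0 ∨ a = 1 := by decide
    rcases h2 (∑ i, x i) with hx | hx
    · simp [parityChar, hx]
    · simp [parityChar, hx, show (1 : ZMod 2) + 1 = 0 from rfl]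
  rw [hcast, Complex.ofReal_eq_zero] at h0
  exact (Finset.sum_pos (fun x _ => sub_pos.2 (hB x)) Finset.univ_nonempty).ne' h0

/-- A state close to `|x⟩ ⊗ |g⟩` is found in `B` more often than in `B'` if `x` vanishes on `B'`
and has norm greater than `2 ε` on `B`. -/
lemma Prepares.blockProb_lt {ε : ℝ} {Φ : StateSpace N m d} {x : EuclideanSpace ℂ (Fin N)}
    (h : Prepares ε Φ x) {B B' : Finset (Fin N)} (hB' : ∀ i ∈ B', x i = 0)
    (hB : (2 * ε) ^ 2 < ∑ i ∈ B, ‖x i‖ ^ 2) : blockProb B' Φ < blockProb B Φ := by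
  classical
  obtain ⟨g, hg, hΦ⟩ := h
  -- `cut B` is the projection onto the outcomes in `B` of the output register
  let cut : Finset (Fin N) → StateSpace N m d → StateSpace N m d := fun B Ψ =>
    WithLp.toLp 2 fun r => if r.1 ∈ B then Ψ r else 0
  have hcut : ∀ B Ψ, ‖cut B Ψ‖ ^ 2 = blockProb B Ψ := by
    intro B Ψ
    rw [EuclideanSpace.norm_sq_eq, blockProb]
    refine Finset.sum_congr rfl fun r _ => ?_
    by_cases hr : r.1 ∈ B <;> simp [cut, hr]
  have hsub : ∀ B Ψ Ψ', cut B (Ψ - Ψ') = cut B Ψ - cut B Ψ' := by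
    intro B Ψ Ψ'
    ext r
    by_cases hr : r.1 ∈ B <;> simp [cut, hr]
  have hle : ∀ B Ψ, ‖cut B Ψ‖ ≤ ‖Ψ‖ := by
    intro B Ψ
    refine le_of_sq_le_sq ?_ (norm_nonneg _)
    rw [hcut, EuclideanSpace.norm_sq_eq, blockProb]
    refine Finset.sum_le_sum fun r _ => ?_
    split_ifs
    · exact le_rfl
    · positivity
  have h0 : cut B' (tensorState x g) = 0 := by
    ext r
    by_cases hr : r.1 ∈ B'
    · simp [cut, hr, tensorState, hB' _ hr]
    · simp [cut, hr]
  have h1 : ‖cut B (tensorState x g)‖ ^ 2 = ∑ i ∈ B, ‖x i‖ ^ 2 := by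
    have hg2 : ∑ q, ‖g q‖ ^ 2 = 1 := by rw [← EuclideanSpace.norm_sq_eq, hg, one_pow]
    rw [hcut, blockProb, Fintype.sum_prod_type, ← Finset.sum_filter_add_sum_filter_not _ (· ∈ B)]
    rw [Finset.filter_mem_eq_inter, Finset.univ_inter, Finset.sum_congr rfl (g := fun i => ‖x i‖ ^ 2),
      Finset.sum_eq_zero (s := Finset.univ.filter (· ∉ B)), add_zero]
    · intro i hi
      simp_all
    · intro i hi
      simp [hi, tensorState, mul_pow, ← Finset.mul_sum, hg2]
  have h2 : 2 * ε < ‖cut B (tensorState x g)‖ := by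
    rw [← h1] at hB
    exact lt_of_pow_lt_pow_left₀ 2 (norm_nonneg _) hB
  have h3 : ‖cut B' Φ‖ ≤ ε := by
    have := (hle B' (Φ - tensorState x g)).trans hΦ
    rwa [hsub, h0, sub_zero] at this
  have h4 : ε < ‖cut B Φ‖ := by
    have := (hle B (Φ - tensorState x g)).trans hΦ
    rw [hsub] at this
    have := norm_sub_norm_le (cut B (tensorState x g)) (cut B Φ)
    rw [norm_sub_rev] at this
    linarith
  rw [← hcut, ← hcut]
  exact pow_lt_pow_left₀ (h3.trans_lt h4) (norm_nonneg _) two_ne_zero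

end PolynomialMethod

/-! ### Canonical position functions -/

/-- Some permutation that lists the elements of `U` in increasing order before all others. -/
lemma exists_perm_eq_orderEmbOfFin {N : ℕ} (U : Finset (Fin N)) :
    ∃ p : Equiv.Perm (Fin N), ∀ ν : Fin N,
      (∀ h : (ν : ℕ) < U.card, p ν = U.orderEmbOfFin rfl ⟨ν, h⟩) ∧
        (U.card ≤ (ν : ℕ) → p ν ∉ U) := by
  have hU : U.card ≤ N := by simpa using U.card_le_univ
  let e : {ν : Fin N // (ν : ℕ) < U.card} ≃ Fin U.card :=
    { toFun := fun ν => ⟨ν.1, ν.2⟩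
      invFun := fun k => ⟨⟨k, k.2.trans_le hU⟩, k.2⟩
      left_inv := fun _ => rfl
      right_inv := fun _ => rfl }
  let e' : {ν : Fin N // (ν : ℕ) < U.card} ≃ {j // j ∈ U} :=
    e.trans (U.orderIsoOfFin rfl).toEquiv
  refine ⟨e'.extendSubtype, fun ν => ⟨fun h => ?_, fun h => ?_⟩⟩
  · exact e'.extendSubtype_apply_of_mem ν h
  · exact e'.extendSubtype_not_mem ν (not_lt.2 h)

/-- A permutation of the columns that lists the elements of `U` in increasing order before all
others. -/
noncomputable def listingPerm {N : ℕ} (U : Finset (Fin N)) : Equiv.Perm (Fin N) :=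
  (exists_perm_eq_orderEmbOfFin U).choose

/-- The oracle that lists the nonzero entries of each row first is admissible for every sparsity;
in row `i` it depends on the matrix only through the support of that row. -/
lemma isPositionFunction_listingPerm {N : ℕ} (s : ℕ) (A : Matrix (Fin N) (Fin N) ℂ) :
    IsPositionFunction s A fun i => listingPerm (rowSupport A i) := fun i ν _ => by
  have h := (exists_perm_eq_orderEmbOfFin (rowSupport A i)).choose_spec ν
  refine ⟨h.1, fun hν => ?_⟩
  have h2 := h.2 hν
  rw [rowSupport, Finset.mem_filter_univ, not_not] at h2
  exact h2

/-! ### The matrices `1 - r P` for a permutation matrix `P` -/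

section PermMatrix

variable {N : ℕ} {r : ℝ} {σ : Equiv.Perm (Fin N)}

/-- The matrix `1 - r P`, where `P` is the permutation matrix `e_j ↦ e_{σ j}`. -/
def oneSubPerm (r : ℝ) (σ : Equiv.Perm (Fin N)) : Matrix (Fin N) (Fin N) ℂ :=
  Matrix.of fun i j => (if i = j then 1 else 0) - if σ.symm i = j then (r : ℂ) else 0

lemma oneSubPerm_apply_mem (i j : Fin N) :
    oneSubPerm r σ i j ∈ ({0, 1, -(r : ℂ), 1 - (r : ℂ)} : Finset ℂ) := by
  simp only [oneSubPerm, Matrix.of_apply]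
  split_ifs <;> simp

lemma isSparse_oneSubPerm {s : ℕ} (hs : 2 ≤ s) : IsSparse s (oneSubPerm r σ) := by
  classical
  constructor
  · intro i
    refine (Finset.card_le_card (t := {i, σ.symm i}) fun j hj => ?_).trans
      (Finset.card_le_two.trans hs)
    by_contra hne
    simp only [Finset.mem_insert, Finset.mem_singleton, not_or] at hne
    rw [rowSupport, Finset.mem_filter_univ] at hj
    exact hj (by simp [oneSubPerm, Ne.symm hne.1, Ne.symm hne.2])
  · intro j
    refine (Finset.card_le_card (t := {j, σ j}) fun i hi => ?_).trans
      (Finset.card_le_two.trans hs)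
    by_contra hne
    simp only [Finset.mem_insert, Finset.mem_singleton, not_or] at hne
    rw [colSupport, Finset.mem_filter_univ] at hi
    exact hi (by simp [oneSubPerm, hne.1, Equiv.symm_apply_eq, hne.2])

lemma toEuclideanCLM_oneSubPerm (v : EuclideanSpace ℂ (Fin N)) :
    Matrix.toEuclideanCLM (n := Fin N) (𝕜 := ℂ) (oneSubPerm r σ) v =
      v - (r : ℂ) • LinearIsometryEquiv.piLpCongrLeft 2 ℂ ℂ σ v := by
  ext i
  simp [Matrix.ofLp_toEuclideanCLM, Matrix.mulVec, dotProduct, oneSubPerm, sub_mul,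
    Finset.sum_sub_distrib, LinearIsometryEquiv.piLpCongrLeft_apply]

lemma norm_toEuclideanCLM_oneSubPerm_le (hr : 0 ≤ r) (v : EuclideanSpace ℂ (Fin N)) :
    ‖Matrix.toEuclideanCLM (n := Fin N) (𝕜 := ℂ) (oneSubPerm r σ) v‖ ≤ (1 + r) * ‖v‖ := by
  rw [toEuclideanCLM_oneSubPerm]
  refine (norm_sub_le _ _).trans_eq ?_
  rw [norm_smul, LinearIsometryEquiv.norm_map, Complex.norm_of_nonneg hr]
  ring

lemma le_norm_toEuclideanCLM_oneSubPerm (hr : 0 ≤ r) (v : EuclideanSpace ℂ (Fin N)) :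
    (1 - r) * ‖v‖ ≤ ‖Matrix.toEuclideanCLM (n := Fin N) (𝕜 := ℂ) (oneSubPerm r σ) v‖ := by
  rw [toEuclideanCLM_oneSubPerm]
  refine le_trans (le_of_eq ?_) (norm_sub_norm_le _ _)
  rw [norm_smul, LinearIsometryEquiv.norm_map, Complex.norm_of_nonneg hr]
  ring

lemma isUnit_oneSubPerm (hr : 0 ≤ r) (hr1 : r < 1) : IsUnit (oneSubPerm r σ) := by
  rw [← Matrix.mulVec_injective_iff_isUnit]
  refine (injective_iff_map_eq_zero (oneSubPerm r σ).mulVecLin).2 fun v hv => ?_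
  have h := le_norm_toEuclideanCLM_oneSubPerm (σ := σ) hr (WithLp.toLp 2 v)
  rw [Matrix.toEuclideanCLM_toLp, ← Matrix.mulVecLin_apply, hv, WithLp.toLp_zero, norm_zero] at h
  have h0 : ‖WithLp.toLp 2 v‖ = 0 :=
    le_antisymm (nonpos_of_mul_nonpos_right h (sub_pos.2 hr1)) (norm_nonneg _)
  simpa using h0

lemma solutionVec_eq_of_toEuclideanCLM_eq {A : Matrix (Fin N) (Fin N) ℂ} (hA : IsUnit A)
    {w b : EuclideanSpace ℂ (Fin N)}
    (h : Matrix.toEuclideanCLM (n := Fin N) (𝕜 := ℂ) A w = b) : solutionVec A b = w := by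
  rw [solutionVec, ← h, ← mul_apply_eq_comp, ← map_mul,
    Matrix.nonsing_inv_mul _ ((Matrix.isUnit_iff_isUnit_det A).1 hA), map_one,
    one_apply_eq_self]

/-- If `σ` swaps two indices, then `P` has the eigenvalues `1` and `-1`, so the bounds `1 + r` on
the norm and `1 / (1 - r)` on the norm of the inverse are attained. -/
lemma condNumber_oneSubPerm (hr : 0 ≤ r) (hr1 : r < 1) {a b : Fin N} (hab : a ≠ b)
    (h1 : σ a = b) (h2 : σ b = a) : condNumber (oneSubPerm r σ) = (1 + r) / (1 - r) := by
  have hr1' : 0 < 1 - r := sub_pos.2 hr1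
  have hu := isUnit_oneSubPerm (σ := σ) hr hr1
  -- eigenvectors for the eigenvalues `1` and `-1` of the permutation
  let u : ℂ → EuclideanSpace ℂ (Fin N) := fun t =>
    EuclideanSpace.single a 1 + t • EuclideanSpace.single b 1
  have hu0 : ∀ t, 0 < ‖u t‖ := by
    intro t
    rw [norm_pos_iff]
    intro h
    simpa [u, hab] using congrArg (fun v : EuclideanSpace ℂ (Fin N) => v a) h
  have heig : ∀ t : ℂ, t * t = 1 →
      Matrix.toEuclideanCLM (n := Fin N) (𝕜 := ℂ) (oneSubPerm r σ) (u t) = (1 - r * t) • u t := by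
    intro t ht
    rw [toEuclideanCLM_oneSubPerm]
    simp only [u, map_add, map_smul, LinearIsometryEquiv.piLpCongrLeft_single, h1, h2]
    ext i
    simp only [PiLp.add_apply, PiLp.sub_apply, PiLp.smul_apply, smul_eq_mul]
    linear_combination (r : ℂ) * (EuclideanSpace.single b (1 : ℂ)).ofLp i * ht
  have hnorm : ‖Matrix.toEuclideanCLM (n := Fin N) (𝕜 := ℂ) (oneSubPerm r σ)‖ = 1 + r := by
    refine le_antisymm (ContinuousLinearMap.opNorm_le_bound _ (by linarith)
      (norm_toEuclideanCLM_oneSubPerm_le hr)) ?_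
    have h := ContinuousLinearMap.le_opNorm
      (Matrix.toEuclideanCLM (n := Fin N) (𝕜 := ℂ) (oneSubPerm r σ)) (u (-1))
    rw [heig (-1) (by ring), norm_smul] at h
    have h3 : ‖(1 - (r : ℂ) * -1)‖ = 1 + r := by
      rw [show (1 - (r : ℂ) * -1) = ((1 + r : ℝ) : ℂ) by push_cast; ring,
        Complex.norm_of_nonneg (by linarith)]
    rw [h3] at h
    exact le_of_mul_le_mul_right h (hu0 _)
  have hinv : ‖Matrix.toEuclideanCLM (n := Fin N) (𝕜 := ℂ) (oneSubPerm r σ)⁻¹‖ =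
      (1 - r)⁻¹ := by
    refine le_antisymm (ContinuousLinearMap.opNorm_le_bound _ (inv_pos.2 hr1').le fun v => ?_) ?_
    · have h := le_norm_toEuclideanCLM_oneSubPerm (σ := σ) hr
        (Matrix.toEuclideanCLM (n := Fin N) (𝕜 := ℂ) (oneSubPerm r σ)⁻¹ v)
      rw [← mul_apply_eq_comp, ← map_mul,
        Matrix.mul_nonsing_inv _ ((Matrix.isUnit_iff_isUnit_det _).1 hu), map_one,
        one_apply_eq_self] at h
      rwa [inv_mul_eq_div, le_div_iff₀' hr1']
    · have h := ContinuousLinearMap.le_opNorm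
        (Matrix.toEuclideanCLM (n := Fin N) (𝕜 := ℂ) (oneSubPerm r σ)⁻¹) ((1 - (r : ℂ) * 1) • u 1)
      have h3 : ‖(1 - (r : ℂ) * 1)‖ = 1 - r := by
        rw [show (1 - (r : ℂ) * 1) = ((1 - r : ℝ) : ℂ) by push_cast; ring,
          Complex.norm_of_nonneg hr1'.le]
      have h4 := solutionVec_eq_of_toEuclideanCLM_eq hu (heig 1 (by ring))
      rw [solutionVec] at h4
      rw [h4, norm_smul, h3, ← mul_assoc] at h
      rw [inv_le_iff_one_le_mul₀ hr1']
      exact le_of_mul_le_mul_right (by rwa [one_mul]) (hu0 1)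
  rw [condNumber, hnorm, hinv, div_eq_mul_inv]

lemma rowsDependOnOneBit_oneSubPerm {m : ℕ} {ι : Type*} {r : ℝ}
    {σ : (ι → ZMod 2) → Equiv.Perm (Fin N)} (F : NumberFormat m)
    (h : ∀ i, ∃ S : Finset ι, S.card ≤ 1 ∧ DependsOn (fun x => (σ x).symm i) (S : Set ι)) :
    RowsDependOnOneBit (fun x i => listingPerm (rowSupport (oneSubPerm r (σ x)) i))
      (fun x i j => F.code (oneSubPerm r (σ x) i j)) := by
  intro i
  obtain ⟨S, hS, hdep⟩ := h i
  refine ⟨S, hS, fun x y hxy => ?_⟩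
  have hrow : oneSubPerm r (σ x) i = oneSubPerm r (σ y) i := by
    ext j
    have : (σ x).symm i = (σ y).symm i := hdep hxy
    simp [oneSubPerm, this]
  simp only [rowSupport, hrow]

end PermMatrix

/-! ### A walk that computes and uncomputes a parity -/

/-- The parity bit carried by the walk at time `k`: the bit `x j` is added in step `j`, and added
once more, hence removed, in step `j + h`. -/
def walkParity {n : ℕ} (h : ℕ) (x : Fin n → ZMod 2) (k : ℕ) : ZMod 2 :=
  ∑ j : Fin n, if (j : ℕ) < k ∧ k ≤ j + h then x j else 0

section Walk

variable {n h L R : ℕ}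

lemma walkParity_zero (x : Fin n → ZMod 2) : walkParity h x 0 = 0 := by
  simp [walkParity]

lemma walkParity_add (x : Fin n → ZMod 2) : walkParity h x (n + h) = 0 := by
  refine Finset.sum_eq_zero fun j _ => if_neg ?_
  omega

lemma walkParity_eq_sum (x : Fin n → ZMod 2) {k : ℕ} (h1 : n ≤ k) (h2 : k ≤ h) :
    walkParity h x k = ∑ j, x j :=
  Finset.sum_congr rfl fun j _ => if_pos (by omega)

/-- Each step of the walk depends on at most one bit. -/
lemma exists_dependsOn_walkParity_sub (hn : n ≤ h) (k : ℕ) : ∃ S : Finset (Fin n), S.card ≤ 1 ∧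
    DependsOn (fun x => walkParity h x (k + 1) - walkParity h x k) (S : Set (Fin n)) := by
  classical
  refine ⟨Finset.univ.filter fun j => (j : ℕ) = k ∨ (j : ℕ) + h = k, ?_, fun x y hxy => ?_⟩
  · refine Finset.card_le_one.2 fun i hi j hj => ?_
    simp only [Finset.mem_filter_univ] at hi hj
    omega
  · simp only [walkParity, ← Finset.sum_sub_distrib]
    refine Finset.sum_congr rfl fun j _ => ?_
    by_cases hj : (j : ℕ) = k ∨ (j : ℕ) + h = k
    · rw [hxy j (by simpa using hj)]
    · have : ((j : ℕ) < k + 1 ∧ k + 1 ≤ j + h) ↔ ((j : ℕ) < k ∧ k ≤ j + h) := by omega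
      simp only [this, sub_self]

lemma walkParity_finRotate (hL : L + 1 = n + h) (x : Fin n → ZMod 2) (k : Fin (L + 1)) :
    walkParity h x (finRotate (L + 1) k) = walkParity h x (k + 1) := by
  rw [coe_finRotate]
  split_ifs with hk
  · rw [hk, Fin.val_last, hL, walkParity_zero, walkParity_add]
  · rfl

/-- The walk: on the first summand a cyclic step of the time that updates the parity bit, on the
second one the exchange of two points. -/
def walkPerm (h L R : ℕ) (x : Fin n → ZMod 2) :
    Equiv.Perm ((Fin (L + 1) × ZMod 2) ⊕ Fin (R + 2)) :=
  Equiv.sumCongr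
    (Equiv.prodShear (finRotate (L + 1)) fun k =>
      Equiv.addRight (walkParity h x (k + 1) - walkParity h x k))
    (Equiv.swap 0 1)

lemma exists_dependsOn_walkPerm_symm (hn : n ≤ h) (q : (Fin (L + 1) × ZMod 2) ⊕ Fin (R + 2)) :
    ∃ S : Finset (Fin n), S.card ≤ 1 ∧
      DependsOn (fun x => (walkPerm h L R x).symm q) (S : Set (Fin n)) := by
  rcases q with ⟨k, p⟩ | j
  · obtain ⟨S, hS, hdep⟩ := exists_dependsOn_walkParity_sub hn ((finRotate (L + 1)).symm k)
    refine ⟨S, hS, fun x y hxy => ?_⟩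
    exact congrArg (fun a => Sum.inl ((finRotate (L + 1)).symm k, (Equiv.addRight a).symm p))
      (hdep hxy)
  · exact ⟨∅, by simp, fun x y _ => rfl⟩

/-! ### The solution along the walk -/

variable {N : ℕ} {r : ℝ}

/-- The geometrically decaying vector `∑ k, r ^ k |k, parity at time k⟩` along the walk. -/
def walkVec (h : ℕ) (e : Fin N ≃ (Fin (L + 1) × ZMod 2) ⊕ Fin (R + 2)) (r : ℝ)
    (x : Fin n → ZMod 2) : EuclideanSpace ℂ (Fin N) :=
  WithLp.toLp 2 fun i =>
    Sum.elim (fun q => if q.2 = walkParity h x q.1 then (r : ℂ) ^ (q.1 : ℕ) else 0) (fun _ => 0)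
      (e i)

/-- In `1 + r P + r ^ 2 P ^ 2 + ⋯` applied to the starting point all terms but the first and the
last cancel under `1 - r P`; the last one is back at the starting point. -/
lemma toEuclideanCLM_walkVec (hL : L + 1 = n + h)
    (e : Fin N ≃ (Fin (L + 1) × ZMod 2) ⊕ Fin (R + 2)) (x : Fin n → ZMod 2) :
    Matrix.toEuclideanCLM (n := Fin N) (𝕜 := ℂ)
        (oneSubPerm r (e.symm.permCongr (walkPerm h L R x))) (walkVec h e r x) =
      ((1 - r ^ (L + 1) : ℝ) : ℂ) • EuclideanSpace.single (e.symm (Sum.inl (0, 0))) 1 := by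
  have hsymm : ∀ q, (e.symm.permCongr (walkPerm h L R x)).symm (e.symm (walkPerm h L R x q)) =
      e.symm q := by
    intro q
    rw [Equiv.symm_apply_eq]
    simp
  rw [toEuclideanCLM_oneSubPerm]
  ext i
  obtain ⟨q, rfl⟩ := e.symm.surjective i
  obtain ⟨q, rfl⟩ := (walkPerm h L R x).surjective q
  rcases q with ⟨k, p⟩ | j
  · have hk : p + (walkParity h x (k + 1) - walkParity h x k) =
        walkParity h x (finRotate (L + 1) k) ↔ p = walkParity h x k := by
      rw [walkParity_finRotate hL, add_sub_left_comm, add_eq_left, sub_eq_zero]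
    have hstep : walkPerm h L R x (Sum.inl (k, p)) =
        Sum.inl (finRotate (L + 1) k, p + (walkParity h x (k + 1) - walkParity h x k)) := rfl
    have hback := hsymm (Sum.inl (k, p))
    rw [hstep] at hback ⊢
    simp only [LinearIsometryEquiv.piLpCongrLeft_apply, walkVec, PiLp.sub_apply, PiLp.smul_apply,
      Equiv.piCongrLeft'_apply, hback, Equiv.apply_symm_apply, Sum.elim_inl, smul_eq_mul, hk,
      PiLp.single_apply, e.symm.injective.eq_iff, Sum.inl.injEq, Prod.mk.injEq]
    by_cases hp : p = walkParity h x k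
    · rw [if_pos hp, if_pos hp, hk.2 hp]
      by_cases hlast : k = Fin.last L
      · rw [hlast, finRotate_last]
        simp [walkParity_zero, pow_succ, mul_comm]
      · have h0 : finRotate (L + 1) k ≠ 0 := fun h0 => by
          simpa [h0] using coe_finRotate_of_ne_last hlast
        rw [if_neg fun h => h0 h.1, coe_finRotate_of_ne_last hlast]
        ring
    · rw [if_neg hp, if_neg hp, if_neg]
      · ring
      · rintro ⟨h0, h1⟩
        exact hp (hk.1 (by rw [h1, h0, Fin.val_zero, walkParity_zero]))
  · simp only [LinearIsometryEquiv.piLpCongrLeft_apply, walkVec, PiLp.sub_apply, PiLp.smul_apply,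
      Equiv.piCongrLeft'_apply, hsymm]
    simp [walkPerm]

lemma solutionState_eq_of_toEuclideanCLM_eq {A : Matrix (Fin N) (Fin N) ℂ} (hA : IsUnit A)
    {w b : EuclideanSpace ℂ (Fin N)} {a : ℝ} (ha : 0 < a)
    (h : Matrix.toEuclideanCLM (n := Fin N) (𝕜 := ℂ) A w = (a : ℂ) • b) :
    solutionState A b = ((‖w‖⁻¹ : ℝ) : ℂ) • w := by
  have ha' : (a : ℂ) ≠ 0 := Complex.ofReal_ne_zero.2 ha.ne'
  have hs : solutionVec A b = (a : ℂ)⁻¹ • w := by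
    refine solutionVec_eq_of_toEuclideanCLM_eq hA ?_
    rw [map_smul, h, inv_smul_smul₀ ha']
  rw [solutionState, hs, norm_smul, norm_inv, Complex.norm_of_nonneg ha.le, smul_smul, mul_inv,
    inv_inv, Complex.ofReal_mul, mul_right_comm, mul_inv_cancel₀ ha', one_mul]

open Classical in
/-- The indices at which the time is in `[n, h)` and the parity bit is `p`. At these times the
walk carries the parity of all bits. -/
noncomputable def walkBlock (n h : ℕ) (e : Fin N ≃ (Fin (L + 1) × ZMod 2) ⊕ Fin (R + 2))
    (p : ZMod 2) : Finset (Fin N) :=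
  Finset.univ.filter fun i =>
    Sum.elim (fun q => (n ≤ (q.1 : ℕ) ∧ (q.1 : ℕ) < h) ∧ q.2 = p) (fun _ => False) (e i)

lemma walkVec_eq_zero_of_mem_walkBlock (e : Fin N ≃ (Fin (L + 1) × ZMod 2) ⊕ Fin (R + 2))
    (x : Fin n → ZMod 2) {i : Fin N} (hi : i ∈ walkBlock n h e (∑ j, x j + 1)) :
    walkVec h e r x i = 0 := by
  obtain ⟨q, rfl⟩ := e.symm.surjective i
  rcases q with ⟨k, p⟩ | j
  · simp only [walkBlock, Finset.mem_filter_univ, Equiv.apply_symm_apply, Sum.elim_inl] at hi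
    simp [walkVec, walkParity_eq_sum x hi.1.1 hi.1.2.le, hi.2]
  · simp [walkVec]

lemma norm_walkVec_sq (e : Fin N ≃ (Fin (L + 1) × ZMod 2) ⊕ Fin (R + 2)) (x : Fin n → ZMod 2) :
    ‖walkVec h e r x‖ ^ 2 = ∑ k ∈ Finset.range (L + 1), (r ^ 2) ^ k := by
  rw [EuclideanSpace.norm_sq_eq, ← Equiv.sum_comp e.symm, Fintype.sum_sum_type,
    Fintype.sum_prod_type, ← Fin.sum_univ_eq_sum_range]
  simp [walkVec, apply_ite, ite_pow, pow_right_comm _ _ 2]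

lemma sum_walkBlock_norm_sq (hh : h ≤ L + 1)
    (e : Fin N ≃ (Fin (L + 1) × ZMod 2) ⊕ Fin (R + 2)) (x : Fin n → ZMod 2) :
    ∑ i ∈ walkBlock n h e (∑ j, x j), ‖walkVec h e r x i‖ ^ 2 =
      ∑ k ∈ Finset.Ico n h, (r ^ 2) ^ k := by
  classical
  have hIco : Finset.Ico n h = (Finset.range (L + 1)).filter fun k => n ≤ k ∧ k < h := by
    ext k
    simp
    omega
  rw [hIco, Finset.sum_filter, ← Fin.sum_univ_eq_sum_range (fun k => if n ≤ k ∧ k < h then _ else _),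
    walkBlock, Finset.sum_filter, ← Equiv.sum_comp e.symm, Fintype.sum_sum_type,
    Fintype.sum_prod_type]
  simp only [Equiv.apply_symm_apply, Sum.elim_inl, Sum.elim_inr, if_false, Finset.sum_const_zero,
    add_zero]
  refine Finset.sum_congr rfl fun k _ => ?_
  by_cases hk : n ≤ (k : ℕ) ∧ (k : ℕ) < h
  · simp [hk, walkVec, walkParity_eq_sum x hk.1 hk.2.le, pow_right_comm _ _ 2]
  · simp [hk]

/-- If more than the fraction `4 ε²` of the weight of the solution lies at the times in `[n, h)`,
then an algorithm computes the parity of `n` bits and makes at least `n / 2` calls. -/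
theorem le_two_mul_queryCount_of_solves {m s : ℕ} {κ ε : ℝ} (hs : 2 ≤ s) (hn : n ≤ h)
    (hL : L + 1 = n + h) (hr : 0 ≤ r) (hr1 : r < 1) (hκ : (1 + r) / (1 - r) = κ)
    (hε : (2 * ε) ^ 2 < (r ^ 2) ^ n - (r ^ 2) ^ h) (F : NumberFormat m)
    (hF : ({0, 1, -(r : ℂ), 1 - (r : ℂ)} : Finset ℂ) ⊆ F.values)
    (e : Fin N ≃ (Fin (L + 1) × ZMod 2) ⊕ Fin (R + 2)) (alg : QueryAlgorithm N m)
    (halg : Solves s κ ε F (EuclideanSpace.single (e.symm (Sum.inl (0, 0))) 1) alg) :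
    n ≤ 2 * alg.queryCount := by
  let σ : (Fin n → ZMod 2) → Equiv.Perm (Fin N) := fun x => e.symm.permCongr (walkPerm h L R x)
  have hrow := rowsDependOnOneBit_oneSubPerm (r := r) (σ := σ) F fun i => by
    obtain ⟨S, hS, hdep⟩ := exists_dependsOn_walkPerm_symm (L := L) (R := R) hn (e i)
    exact ⟨S, hS, fun x y hxy => congrArg e.symm (hdep hxy)⟩
  have key := alg.card_le_two_mul_queryCount hrow (walkBlock n h e) fun x => ?_
  · simpa using key
  have hA := isUnit_oneSubPerm (σ := σ x) hr hr1
  have hcond : condNumber (oneSubPerm r (σ x)) = κ := by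
    rw [← hκ]
    refine condNumber_oneSubPerm hr hr1 (a := e.symm (Sum.inr 0)) (b := e.symm (Sum.inr 1))
      (by simp) ?_ ?_ <;> simp [σ, walkPerm]
  have hprep := halg _ hA (isSparse_oneSubPerm hs) hcond (fun i j => hF (oneSubPerm_apply_mem i j))
    _ (isPositionFunction_listingPerm s _)
  have hr2 : r ^ 2 < 1 := by nlinarith
  rw [solutionState_eq_of_toEuclideanCLM_eq hA
    (sub_pos.2 (pow_lt_one₀ hr hr1 (Nat.succ_ne_zero L))) (toEuclideanCLM_walkVec hL e x)] at hprep
  refine hprep.blockProb_lt (fun i hi => ?_) ?_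
  · simp [walkVec_eq_zero_of_mem_walkBlock e x hi]
  have hgeom : (∑ k ∈ Finset.range (L + 1), (r ^ 2) ^ k) * (1 - r ^ 2) ≤ 1 := by
    rw [geom_sum_mul_neg]
    have : 0 ≤ (r ^ 2) ^ (L + 1) := by positivity
    linarith
  have hpos : 0 < ∑ k ∈ Finset.range (L + 1), (r ^ 2) ^ k := by
    rw [Finset.sum_range_succ', pow_zero]
    positivity
  have hblock : (∑ k ∈ Finset.Ico n h, (r ^ 2) ^ k) * (1 - r ^ 2) = (r ^ 2) ^ n - (r ^ 2) ^ h := by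
    rw [Finset.sum_Ico_eq_sub _ hn, sub_mul, geom_sum_mul_neg, geom_sum_mul_neg]
    ring
  have hsum : ∑ i ∈ walkBlock n h e (∑ j, x j),
      ‖(((‖walkVec h e r x‖⁻¹ : ℝ) : ℂ) • walkVec h e r x) i‖ ^ 2 =
      (∑ k ∈ Finset.Ico n h, (r ^ 2) ^ k) / ∑ k ∈ Finset.range (L + 1), (r ^ 2) ^ k := by
    rw [← norm_walkVec_sq (h := h) e x, ← sum_walkBlock_norm_sq (by omega) e x, Finset.sum_div]
    refine Finset.sum_congr rfl fun i _ => ?_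
    simp [mul_pow, div_eq_inv_mul]
  rw [hsum, lt_div_iff₀ hpos]
  refine lt_of_mul_lt_mul_right ?_ (sub_pos.2 hr2).le
  calc (2 * ε) ^ 2 * (∑ k ∈ Finset.range (L + 1), (r ^ 2) ^ k) * (1 - r ^ 2)
      ≤ (2 * ε) ^ 2 := by
        rw [mul_assoc]
        exact mul_le_of_le_one_right (by positivity) hgeom
    _ < _ := by rwa [hblock]

end Walk

/-! ### The choice of the parameters -/

/-- With `r = (κ - 1) / (κ + 1)`, about `κ log (1 / ε) / 4` steps shrink the solution by a factor
of no less than `√ε`, and `κ + 1` further steps take up most of the remaining weight. -/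
lemma weight_bound {κ ε : ℝ} (hκ : 9 ≤ κ) (hε : 0 < ε) (hε6 : ε < 1 / 6) {n M : ℕ}
    (hn : (n : ℝ) ≤ (κ - 1) * Real.log (1 / ε) / 4) (hM : κ + 1 ≤ M) :
    (2 * ε) ^ 2 < (((κ - 1) / (κ + 1)) ^ 2) ^ n - (((κ - 1) / (κ + 1)) ^ 2) ^ (n + M) := by
  set r := (κ - 1) / (κ + 1) with hr
  have hr0 : 0 < r := div_pos (by linarith) (by linarith)
  have hlog : Real.log (1 / ε) = -Real.log ε := by rw [one_div, Real.log_inv]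
  -- `1 - 1 / r = -2 / (κ - 1)` bounds `log r` from below, `r - 1 = -2 / (κ + 1)` from above
  have hlow : -2 / (κ - 1) ≤ Real.log r := by
    refine le_trans (le_of_eq ?_) (Real.one_sub_inv_le_log_of_pos hr0)
    rw [hr]
    have : κ - 1 ≠ 0 := by linarith
    have : κ + 1 ≠ 0 := by linarith
    field_simp
    ring
  have hup : Real.log r ≤ -2 / (κ + 1) := by
    refine (Real.log_le_sub_one_of_pos hr0).trans (le_of_eq ?_)
    rw [hr]
    have : κ + 1 ≠ 0 := by linarith
    field_simp
    ring
  have hpow : ∀ k : ℕ, (r ^ 2) ^ k = Real.exp (2 * k * Real.log r) := by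
    intro k
    rw [← pow_mul, ← Real.exp_log (pow_pos hr0 _), Real.log_pow]
    push_cast
    rfl
  have h1 : ε ≤ (r ^ 2) ^ n := by
    rw [hpow, ← Real.log_le_iff_le_exp hε]
    have h2 : (n : ℝ) * (2 / (κ - 1)) ≤ -Real.log ε / 2 := by
      rw [mul_div_assoc', div_le_iff₀ (by linarith)]
      rw [hlog] at hn
      linarith
    have h3 : (n : ℝ) * (-2 / (κ - 1)) ≤ n * Real.log r :=
      mul_le_mul_of_nonneg_left hlow n.cast_nonneg
    rw [neg_div, mul_neg] at h3
    linarith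
  have h2 : (r ^ 2) ^ M ≤ 1 / 3 := by
    rw [hpow]
    have h3 : 2 * (M : ℝ) * Real.log r ≤ -4 := by
      have h4 : (M : ℝ) * Real.log r ≤ M * (-2 / (κ + 1)) :=
        mul_le_mul_of_nonneg_left hup M.cast_nonneg
      have h5 : (2 : ℝ) ≤ M * (2 / (κ + 1)) := by
        rw [mul_div_assoc', le_div_iff₀ (by linarith)]
        linarith
      rw [neg_div, mul_neg] at h4
      linarith
    refine (Real.exp_le_exp.2 h3).trans ?_
    rw [Real.exp_neg, ← one_div]
    refine one_div_le_one_div_of_le (by norm_num) ?_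
    linarith [Real.add_one_le_exp (4 : ℝ)]
  calc (2 * ε) ^ 2 < ε * (2 / 3) := by nlinarith
    _ ≤ (r ^ 2) ^ n * (1 - (r ^ 2) ^ M) :=
      mul_le_mul h1 (by linarith) (by norm_num) (hε.le.trans h1)
    _ = _ := by ring

end QLS

theorem mainTheorem2 :
    ∃ c C κ₀ : ℝ, 0 < c ∧ 0 < C ∧ ∀ κ : ℝ, κ₀ ≤ κ →
      ∃ V : Finset ℂ, ∀ s : ℕ, 2 ≤ s → ∀ ε : ℝ, 0 < ε → ε < 1 / 6 →
        ∀ N : ℕ, C * (κ * Real.log (1 / ε)) ≤ N →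
          ∀ (m : ℕ) (F : QLS.NumberFormat m), V ⊆ F.values →
            ENNReal.ofReal (c * (κ * Real.log (1 / ε))) ≤
              ((QLS.queryComplexity N s κ ε F : ℕ∞) : ℝ≥0∞) := by
  refine ⟨1 / 32, 10, 9, by norm_num, by norm_num, fun κ hκ => ?_⟩
  set r : ℝ := (κ - 1) / (κ + 1) with hr
  refine ⟨{0, 1, -(r : ℂ), 1 - (r : ℂ)}, fun s hs ε hε hε6 N hN m F hF => ?_⟩
  set ℓ := Real.log (1 / ε) with hℓ
  have hℓ1 : 1 ≤ ℓ := by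
    rw [hℓ, Real.le_log_iff_exp_le (by positivity)]
    have : 6 < 1 / ε := by
      rw [lt_div_iff₀ hε]
      linarith
    linarith [Real.exp_one_lt_d9]
  have hκℓ : κ ≤ κ * ℓ := le_mul_of_one_le_right (by linarith) hℓ1
  set n := ⌊(κ - 1) * ℓ / 4⌋₊ with hn
  set M := ⌈κ + 1⌉₊ with hM
  have hpos : 0 ≤ (κ - 1) * ℓ / 4 := by
    have : 0 ≤ (κ - 1) * ℓ := mul_nonneg (by linarith) (by linarith)
    linarith
  have hn1 : (n : ℝ) ≤ (κ - 1) * ℓ / 4 := Nat.floor_le hpos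
  have hn2 : (κ - 1) * ℓ / 4 < n + 1 := Nat.lt_floor_add_one _
  have hM1 : κ + 1 ≤ M := Nat.le_ceil _
  have hM2 : (M : ℝ) < κ + 1 + 1 := Nat.ceil_lt_add_one (by linarith)
  have hM0 : 0 < M := by
    have : (0 : ℝ) < M := by linarith
    exact_mod_cast this
  -- the walk needs two points for each of its `2 n + M` times, and two further points
  have hdim : 2 * (2 * n + M) + 2 ≤ N := by
    have : (2 * (2 * n + M) + 2 : ℝ) ≤ N := by nlinarith
    exact_mod_cast this
  obtain ⟨L, hL⟩ : ∃ L, L + 1 = n + (n + M) := ⟨n + (n + M) - 1, by omega⟩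
  obtain ⟨R, hR⟩ : ∃ R, N = 2 * (2 * n + M) + (R + 2) :=
    ⟨N - (2 * (2 * n + M) + 2), by omega⟩
  have e : Fin N ≃ (Fin (L + 1) × ZMod 2) ⊕ Fin (R + 2) := by
    refine Fintype.equivOfCardEq ?_
    simp only [Fintype.card_fin, Fintype.card_sum, Fintype.card_prod, ZMod.card]
    omega
  have hr0 : 0 ≤ r := div_nonneg (by linarith) (by linarith)
  have hr1 : r < 1 := by
    rw [hr, div_lt_one (by linarith)]
    linarith
  have hcond : (1 + r) / (1 - r) = κ := by
    have h1 : κ + 1 ≠ 0 := by linarith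
    rw [div_eq_iff (by linarith), hr]
    field_simp
    ring
  have key : ((⌈(n / 2 : ℝ)⌉₊ : ℕ) : ℕ∞) ≤ ⨅ alg : {alg : QLS.QueryAlgorithm N m //
      QLS.Solves s κ ε F (EuclideanSpace.single (e.symm (Sum.inl (0, 0))) (1 : ℂ)) alg},
      (alg.1.queryCount : ℕ∞) := by
    refine le_iInf fun alg => ?_
    have h := QLS.le_two_mul_queryCount_of_solves hs (Nat.le_add_right n M) hL hr0 hr1 hcond
      (QLS.weight_bound hκ hε hε6 hn1 hM1) F hF e alg.1 alg.2
    rw [Nat.cast_le, Nat.ceil_le, div_le_iff₀ two_pos, mul_comm]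
    exact_mod_cast h
  have hsup := key.trans (le_iSup (fun b : {b : EuclideanSpace ℂ (Fin N) // ‖b‖ = 1} =>
    ⨅ alg : {alg : QLS.QueryAlgorithm N m // QLS.Solves s κ ε F b.1 alg},
      (alg.1.queryCount : ℕ∞)) ⟨EuclideanSpace.single (e.symm (Sum.inl (0, 0))) 1, by simp⟩)
  refine le_trans ?_ (ENat.toENNReal_le.2 hsup)
  rw [ENat.toENNReal_coe, ← ENNReal.ofReal_natCast]
  refine ENNReal.ofReal_le_ofReal (le_trans ?_ (Nat.le_ceil _))
  nlinarith
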